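/- Let $\mathcal{E}$ be an elementary topos with a chosen terminal object $1$ and chosen binary products. Let $(\Sigma,E)$ be a presentation of a variety: a set $\Sigma$ of operation symbols of finite arity and a set $E$ of equations between $\Sigma$-terms. Let $(Q,\otimes,k,\bigvee)$ be an internal commutative quantale in $\mathcal{E}$, i.e. an internal commutative monoid with an internal partial order for which every subset has a join $\bigvee:\Omega^Q\to Q$, such that in the internal language $a\otimes\bigvee B=\bigvee\{a\otimes b\mid b\in B\}$ and $(\bigvee A)\otimes b=\bigvee\{a\otimes b\mid a\in A\}$. Let $\mathbf{Rel}_{(\Sigma,E)}(Q)$ be the following symmetric monoidal category, described in the internal language of $\mathcal{E}$. Its objects are the $(\Sigma,E)$-algebras in $\mathcal{E}$. A morphism $A\to B$ is an algebraic $Q$-relation, i.e. a morphism $R:A\times B\to Q$ of $\mathcal{E}$ such that, for every $\sigma\in\Sigma$ of arity $n$, $$R(a_1,b_1)\otimes\dots\otimes R(a_n,b_n)\le R(\sigma(a_1,\dots,a_n),\sigma(b_1,\dots,b_n)),$$ the left-hand side being $k$ for $n=0$. Identities and composition are $$1_A(a_1,a_2)=\bigvee\{k\mid a_1=a_2\},\qquad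 (S\circ R)(a,c)=\bigvee_b R(a,b)\otimes S(b,c).$$ The tensor product is the product of algebras on objects and $(R\otimes R')((a,a'),(b,b'))=R(a,b)\otimes R'(a',b')$ on morphisms, and the unit is the terminal algebra. The graph of a homomorphism $f:A\to B$ is $f_\circ(a,b)=\bigvee\{k\mid f(a)=b\}$, and the converse of $R$ is $R^\circ(b,a)=R(a,b)$. The associator, unitors and symmetry are the graphs of those of the finite product structure on algebras. Then $\mathbf{Rel}_{(\Sigma,E)}(Q)$ is a hypergraph category, in which the cocommutative comonoid structure on each object $A$ is given by the graphs $$\epsilon_A=(!:A\to 1)_\circ,\qquad \delta_A=(\langle 1_A,1_A\rangle:A\to A\times A)_\circ$$ and the commutative monoid structure by their converses $\eta_A=(\epsilon_A)^\circ$, $\mu_A=(\delta_A)^\circ$. That is, for every object $A$ these form a commutative monoid and a cocommutative comonoid satisfying the Frobenius equations $(\mu\otimes 1)\circ(1\otimes\delta)=\delta\circ\mu=(1\otimes\mu)\circ(\delta\otimes 1)$ and the special equation $\mu\circ\delta=1_A$; and the structures are coherent with the tensor product: up to the canonical coherence isomorphisms, $\delta_{A\otimes B}$, $\epsilon_{A\otimes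 B}$, $\mu_{A\otimes B}$, $\eta_{A\otimes B}$ are the tensor products of the corresponding structures on $A$ and $B$. -/

import Mathlib

open CategoryTheory MonoidalCategory CartesianMonoidalCategory Limits

universe w v u

/-! ## The internal language of an elementary topos

Throughout, an elementary topos is a category `C` with finite limits (with a choice of terminal
object `𝟙_ C` and of binary products `X ⊗ Y`), exponentials and a subobject classifier.
A formula in context `X` is a morphism `X ⟶ Ω C`, a term of type `A` in context `X` is a morphism
`X ⟶ A`. -/

namespace ToposLogic

noncomputable section

open HasSubobjectClassifier MonoidalClosed

variable {C : Type u} [Category.{v} C] [CartesianMonoidalCategory C] [HasFiniteLimits C]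
  [MonoidalClosed C] [HasSubobjectClassifier C]

/-- The formula `⊤` in context `X`. -/
def tt (X : C) : X ⟶ Ω C := Subobject.Classifier.χ₀ _ X ≫ truth C

/-- The formula `p` is valid (in its context). -/
def Holds {X : C} (p : X ⟶ Ω C) : Prop := p = tt X

/-- The formula `a = b`. -/
def eqP {X A : C} (a b : X ⟶ A) : X ⟶ Ω C := lift a b ≫ χ (lift (𝟙 A) (𝟙 A))

/-- The formula `p ∧ q`. -/
def andP {X : C} (p q : X ⟶ Ω C) : X ⟶ Ω C := lift p q ≫ χ (lift (truth C) (truth C))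

/-- The formula `p ⇒ q`, which is `p ∧ q = p`. -/
def impP {X : C} (p q : X ⟶ Ω C) : X ⟶ Ω C := eqP (andP p q) p

/-- The formula `∀ y : Y, p (y, x)`, which is `{y | p (y, x)} = {y | ⊤}`. -/
def allP {X Y : C} (p : Y ⊗ X ⟶ Ω C) : X ⟶ Ω C := eqP (curry p) (curry (tt (Y ⊗ X)))

/-- The formula `∃ y : Y, p (y, x)`, which is `∀ ω : Ω, (∀ y : Y, p (y, x) ⇒ ω) ⇒ ω`. -/
def exP {X Y : C} (p : Y ⊗ X ⟶ Ω C) : X ⟶ Ω C :=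
  allP (Y := Ω C) (impP
    (allP (Y := Y) (impP (Y ◁ snd (Ω C) X ≫ p) (snd Y (Ω C ⊗ X) ≫ fst (Ω C) X)))
    (fst (Ω C) X))

/-- The power object `Ω ^ A`. -/
abbrev Pow (A : C) : C := (ihom A).obj (Ω C)

/-- The formula `a ∈ S`. -/
def memP {X A : C} (a : X ⟶ A) (S : X ⟶ Pow A) : X ⟶ Ω C := lift a S ≫ (ihom.ev A).app (Ω C)

/-- The term `{t (y, x) | y : Y, p (y, x)}` of type `Ω ^ A`, in context `X`:
the set of those `a : A` for which `∃ y : Y, p (y, x) ∧ a = t (y, x)`. -/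
def imageSet {X Y A : C} (p : Y ⊗ X ⟶ Ω C) (t : Y ⊗ X ⟶ A) : X ⟶ Pow A :=
  curry (exP (Y := Y) (andP (Y ◁ snd A X ≫ p)
    (eqP (snd Y (A ⊗ X) ≫ fst A X) (Y ◁ snd A X ≫ t))))

/-! ### Kripke–Joyal semantics -/

lemma comp_tt {X Y : C} (f : X ⟶ Y) : f ≫ tt Y = tt X := by
  unfold tt
  rw [← Category.assoc]
  congr 1
  exact Subsingleton.elim _ _

lemma Holds.comp {X Y : C} {p : Y ⟶ Ω C} (h : Holds p) (f : X ⟶ Y) : Holds (f ≫ p) := by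
  unfold Holds at *; rw [h, comp_tt]

lemma holds_tt (X : C) : Holds (tt X) := rfl

lemma holds_χ {U X Y : C} (m : U ⟶ X) [Mono m] (f : Y ⟶ X) :
    Holds (f ≫ χ m) ↔ ∃ g : Y ⟶ U, g ≫ m = f := by
  constructor
  · intro h
    exact ⟨(isPullback_χ m).lift f (Subobject.Classifier.χ₀ _ Y) h,
      (isPullback_χ m).lift_fst _ _ _⟩
  · rintro ⟨g, rfl⟩
    unfold Holds
    rw [Category.assoc, HasSubobjectClassifier.comm, ← Category.assoc]
    unfold tt
    congr 1
    exact Subsingleton.elim _ _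

lemma holds_eqP {X A : C} (a b : X ⟶ A) : Holds (eqP a b) ↔ a = b := by
  unfold eqP
  rw [holds_χ]
  constructor
  · rintro ⟨g, hg⟩
    have h1 := congrArg (· ≫ fst A A) hg
    have h2 := congrArg (· ≫ snd A A) hg
    simp at h1 h2
    rw [← h1, ← h2]
  · rintro rfl
    exact ⟨a, by ext <;> simp⟩

lemma holds_andP {X : C} (p q : X ⟶ Ω C) : Holds (andP p q) ↔ Holds p ∧ Holds q := by
  unfold andP
  rw [holds_χ]
  constructor
  · rintro ⟨g, hg⟩
    have h1 := congrArg (· ≫ fst _ _) hg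
    have h2 := congrArg (· ≫ snd _ _) hg
    simp at h1 h2
    have e : g = Subobject.Classifier.χ₀ _ X := Subsingleton.elim _ _
    rw [e] at h1 h2
    exact ⟨h1.symm, h2.symm⟩
  · rintro ⟨h1, h2⟩
    refine ⟨Subobject.Classifier.χ₀ _ X, ?_⟩
    ext
    · rw [h1]; simp [tt]
    · rw [h2]; simp [tt]

lemma formula_ext {X : C} {p q : X ⟶ Ω C}
    (h : ∀ {Y : C} (f : Y ⟶ X), Holds (f ≫ p) ↔ Holds (f ≫ q)) : p = q := by
  have key : ∀ (r : X ⟶ Ω C), r = χ (pullback.fst r (truth C)) := by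
    intro r
    apply HasSubobjectClassifier.unique
    have := IsPullback.of_hasPullback r (truth C)
    convert this using 1
    exact Subsingleton.elim _ _
  have hp : Holds (pullback.fst p (truth C) ≫ q) := by
    rw [← h]
    unfold Holds
    rw [pullback.condition]
    unfold tt
    congr 1
    exact Subsingleton.elim _ _
  rw [key p]
  symm
  apply HasSubobjectClassifier.unique
  refine ⟨⟨hp⟩, ⟨PullbackCone.IsLimit.mk _ ?_ ?_ ?_ ?_⟩⟩
  · intro s
    refine pullback.lift s.fst s.snd ?_
    have : Holds (s.fst ≫ p) := by
      rw [h]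
      unfold Holds
      rw [s.condition]
      unfold tt
      congr 1
      exact Subsingleton.elim _ _
    rw [this]
    unfold tt
    congr 1
    exact Subsingleton.elim _ _
  · intro s; exact pullback.lift_fst _ _ _
  · intro s; exact Subsingleton.elim _ _
  · intro s m h1 h2
    rw [← cancel_mono (pullback.fst p (truth C))]
    rw [h1]; exact (pullback.lift_fst _ _ _).symm

lemma comp_eqP {X Y A : C} (f : Y ⟶ X) (a b : X ⟶ A) : f ≫ eqP a b = eqP (f ≫ a) (f ≫ b) := by
  simp [eqP, ← Category.assoc, comp_lift]

lemma comp_andP {X Y : C} (f : Y ⟶ X) (p q : X ⟶ Ω C) :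
    f ≫ andP p q = andP (f ≫ p) (f ≫ q) := by
  simp [andP, ← Category.assoc, comp_lift]

lemma comp_impP {X Y : C} (f : Y ⟶ X) (p q : X ⟶ Ω C) :
    f ≫ impP p q = impP (f ≫ p) (f ≫ q) := by
  simp only [impP, comp_eqP, comp_andP]

lemma comp_allP {X X' Y : C} (f : X' ⟶ X) (p : Y ⊗ X ⟶ Ω C) :
    f ≫ allP p = allP (Y ◁ f ≫ p) := by
  simp only [allP, comp_eqP, ← curry_natural_left, comp_tt]

lemma holds_impP {X : C} (p q : X ⟶ Ω C) :
    Holds (impP p q) ↔ ∀ {Y : C} (f : Y ⟶ X), Holds (f ≫ p) → Holds (f ≫ q) := by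
  unfold impP
  rw [holds_eqP]
  constructor
  · intro h Y f hp
    rw [← h, comp_andP, holds_andP] at hp
    exact hp.2
  · intro h
    apply formula_ext
    intro Y f
    rw [comp_andP, holds_andP]
    exact ⟨fun h => h.1, fun hp => ⟨hp, h f hp⟩⟩

lemma holds_allP {X Y : C} (p : Y ⊗ X ⟶ Ω C) :
    Holds (allP p) ↔ ∀ {Z : C} (f : Z ⟶ X) (y : Z ⟶ Y), Holds (lift y f ≫ p) := by
  unfold allP
  rw [holds_eqP]
  constructor
  · intro h Z f y
    rw [curry_injective h]
    exact (holds_tt _).comp _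
  · intro h
    congr 1
    have := h (snd Y X) (fst Y X)
    simpa [Holds] using this

lemma holds_exP_intro {X Y : C} (p : Y ⊗ X ⟶ Ω C) (y : X ⟶ Y) (h : Holds (lift y (𝟙 X) ≫ p)) :
    Holds (exP p) := by
  unfold exP
  rw [holds_allP]
  intro Z f o
  rw [comp_impP, holds_impP]
  intro W g hg
  rw [comp_allP, comp_allP, holds_allP] at hg
  have := hg (𝟙 W) (g ≫ f ≫ y)
  simp only [comp_impP, holds_impP] at this
  have := this (𝟙 W)
  simp only [Category.id_comp] at this
  have h2 := h.comp (g ≫ f)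
  have e1 : lift (g ≫ f ≫ y) (𝟙 W) ≫ Y ◁ g ≫ Y ◁ lift o f ≫ Y ◁ snd (Ω C) X ≫ p
    = (g ≫ f) ≫ lift y (𝟙 X) ≫ p := by
    simp only [← Category.assoc]
    congr 1
    ext <;> simp
  have e2 : lift (g ≫ f ≫ y) (𝟙 W) ≫ Y ◁ g ≫ Y ◁ lift o f ≫ snd Y (Ω C ⊗ X) ≫ fst (Ω C) X
    = g ≫ o := by simp
  rw [e1, e2] at this
  simpa using this h2

lemma holds_exP_elim {X Y : C} (p : Y ⊗ X ⟶ Ω C) (h : Holds (exP p)) (r : X ⟶ Ω C)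
    (hr : ∀ {Z : C} (f : Z ⟶ X) (y : Z ⟶ Y), Holds (lift y f ≫ p) → Holds (f ≫ r)) :
    Holds r := by
  unfold exP at h
  rw [holds_allP] at h
  have h1 := h (𝟙 X) r
  rw [comp_impP, holds_impP] at h1
  have h2 := h1 (𝟙 X)
  simp only [Category.id_comp, lift_fst] at h2
  apply h2
  rw [comp_allP, holds_allP]
  intro Z f y
  simp only [comp_impP, holds_impP]
  intro W g hg
  have e1 : g ≫ lift y f ≫ Y ◁ lift r (𝟙 X) ≫ Y ◁ snd (Ω C) X ≫ p
    = lift (g ≫ y) (g ≫ f) ≫ p := by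
    simp only [← Category.assoc]
    congr 1
    ext <;> simp
  rw [e1] at hg
  simpa using hr _ _ hg

lemma comp_exP {X X' Y : C} (f : X' ⟶ X) (p : Y ⊗ X ⟶ Ω C) :
    f ≫ exP p = exP (Y ◁ f ≫ p) := by
  unfold exP
  rw [comp_allP, comp_impP, comp_allP, comp_impP]
  congr 2
  · congr 2
    · simp only [← Category.assoc]
      congr 1
      ext <;> simp
    · simp
  · simp

lemma holds_memP_curry {X Z A : C} (p : A ⊗ X ⟶ Ω C) (f : Z ⟶ X) (a : Z ⟶ A) :
    Holds (memP a (f ≫ curry p)) ↔ Holds (lift a f ≫ p) := by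
  unfold memP
  have : lift a (f ≫ curry p) ≫ (ihom.ev A).app (Ω C) = lift a f ≫ p := by
    have : lift a (f ≫ curry p) = lift a f ≫ A ◁ curry p := by ext <;> simp
    rw [this, Category.assoc]
    congr 1
    exact whiskerLeft_curry_ihom_ev_app _ _ _
  rw [this]

lemma mem_imageSet {X Y Z A : C} (p : Y ⊗ X ⟶ Ω C) (t : Y ⊗ X ⟶ A) (f : Z ⟶ X) (y : Z ⟶ Y)
    (h : Holds (lift y f ≫ p)) : Holds (memP (lift y f ≫ t) (f ≫ imageSet p t)) := by
  unfold imageSet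
  rw [holds_memP_curry, comp_exP]
  refine holds_exP_intro _ y ?_
  have e (B : C) (s : Y ⊗ X ⟶ B) :
      lift y (𝟙 Z) ≫ Y ◁ lift (lift y f ≫ t) f ≫ Y ◁ snd A X ≫ s = lift y f ≫ s := by
    simp only [← Category.assoc]
    congr 1
    ext <;> simp
  rw [comp_andP, comp_andP, holds_andP, comp_eqP, comp_eqP, holds_eqP]
  refine ⟨by rwa [e], ?_⟩
  rw [e]
  simp

lemma imageSet_elim {X Y Z A : C} (p : Y ⊗ X ⟶ Ω C) (t : Y ⊗ X ⟶ A) (f : Z ⟶ X) (a : Z ⟶ A)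
    (h : Holds (memP a (f ≫ imageSet p t))) (r : Z ⟶ Ω C)
    (hr : ∀ {W : C} (g : W ⟶ Z) (y : W ⟶ Y), Holds (lift y (g ≫ f) ≫ p) →
      g ≫ a = lift y (g ≫ f) ≫ t → Holds (g ≫ r)) : Holds r := by
  unfold imageSet at h
  rw [holds_memP_curry, comp_exP] at h
  refine holds_exP_elim _ h r ?_
  intro W g y hW
  have e (B : C) (s : Y ⊗ X ⟶ B) :
      lift y g ≫ Y ◁ lift a f ≫ Y ◁ snd A X ≫ s = lift y (g ≫ f) ≫ s := by
    simp only [← Category.assoc]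
    congr 1
    ext <;> simp
  rw [comp_andP, comp_andP, holds_andP, comp_eqP, comp_eqP, holds_eqP, e, e] at hW
  refine hr g y hW.1 ?_
  rw [← hW.2]
  simp

end

end ToposLogic

/-! ## Internal quantales -/

open ToposLogic

/-- An internal quantale in the topos `C`: an object carrying a monoid structure, a partial order
(the formula `le`), and a join operation `sup : Ω ^ Q ⟶ Q` sending every subset to its least upper
bound, such that multiplication distributes over joins on both sides. The axioms are expressed in
the internal language of `C`, by means of generalized elements. -/
structure InternalQuantale (C : Type u) [Category.{v} C] [CartesianMonoidalCategory C]
    [HasFiniteLimits C] [MonoidalClosed C] [HasSubobjectClassifier C] where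
  /-- The underlying object. -/
  carrier : C
  /-- The monoid structure. -/
  [mon : MonObj carrier]
  /-- The order, as a formula with two free variables. -/
  le : carrier ⊗ carrier ⟶ HasSubobjectClassifier.Ω C
  /-- The join operation. -/
  sup : Pow carrier ⟶ carrier
  le_refl : ∀ {X : C} (a : X ⟶ carrier), Holds (lift a a ≫ le)
  le_trans : ∀ {X : C} (a b c : X ⟶ carrier),
    Holds (lift a b ≫ le) → Holds (lift b c ≫ le) → Holds (lift a c ≫ le)
  le_antisymm : ∀ {X : C} (a b : X ⟶ carrier),
    Holds (lift a b ≫ le) → Holds (lift b a ≫ le) → a = b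
  /-- `⋁ S` is an upper bound of `S`. -/
  le_sup : ∀ {X : C} (S : X ⟶ Pow carrier) (b : X ⟶ carrier),
    Holds (memP b S) → Holds (lift b (S ≫ sup) ≫ le)
  /-- `⋁ S` is below every upper bound of `S`. -/
  sup_le : ∀ {X : C} (S : X ⟶ Pow carrier) (c : X ⟶ carrier),
    (∀ {Y : C} (f : Y ⟶ X) (b : Y ⟶ carrier), Holds (memP b (f ≫ S)) →
      Holds (lift b (f ≫ c) ≫ le)) → Holds (lift (S ≫ sup) c ≫ le)
  /-- `a ⊗ ⋁ B = ⋁ {a ⊗ b | b ∈ B}`. -/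
  mul_sup : ∀ {X : C} (a : X ⟶ carrier) (B : X ⟶ Pow carrier),
    lift a (B ≫ sup) ≫ MonObj.mul =
      imageSet (Y := carrier) (memP (fst _ _) (snd _ _ ≫ B))
        (lift (snd _ _ ≫ a) (fst _ _) ≫ MonObj.mul) ≫ sup
  /-- `(⋁ A) ⊗ b = ⋁ {a ⊗ b | a ∈ A}`. -/
  sup_mul : ∀ {X : C} (A : X ⟶ Pow carrier) (b : X ⟶ carrier),
    lift (A ≫ sup) b ≫ MonObj.mul =
      imageSet (Y := carrier) (memP (fst _ _) (snd _ _ ≫ A))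
        (lift (fst _ _) (snd _ _ ≫ b) ≫ MonObj.mul) ≫ sup

attribute [instance] InternalQuantale.mon

namespace InternalQuantale

noncomputable section

open scoped MonObj

variable {C : Type u} [Category.{v} C] [CartesianMonoidalCategory C] [HasFiniteLimits C]
  [MonoidalClosed C] [HasSubobjectClassifier C] (Q : InternalQuantale C)

/-- The order on generalized elements of `Q`. -/
def Le {X : C} (a b : X ⟶ Q.carrier) : Prop := Holds (lift a b ≫ Q.le)

/-- The term `⋁ {t (y, x) | y : Y, p (y, x)}` of type `Q`, in context `X`. -/
def join {X Y : C} (p : Y ⊗ X ⟶ HasSubobjectClassifier.Ω C) (t : Y ⊗ X ⟶ Q.carrier) :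
    X ⟶ Q.carrier := imageSet p t ≫ Q.sup

variable {Q}

lemma Le.refl {X : C} (a : X ⟶ Q.carrier) : Q.Le a a := Q.le_refl a

lemma Le.trans {X : C} {a b c : X ⟶ Q.carrier} (h : Q.Le a b) (h' : Q.Le b c) : Q.Le a c :=
  Q.le_trans a b c h h'

lemma Le.comp {X Y : C} {a b : X ⟶ Q.carrier} (h : Q.Le a b) (f : Y ⟶ X) :
    Q.Le (f ≫ a) (f ≫ b) := by
  have := Holds.comp h f
  rwa [← Category.assoc, comp_lift] at this

lemma eq_of_le_iff {X : C} {a b : X ⟶ Q.carrier} (h : ∀ c, Q.Le a c ↔ Q.Le b c) : a = b :=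
  Q.le_antisymm a b ((h b).2 (Le.refl b)) ((h a).1 (Le.refl a))

lemma comp_mul' {X Y : C} (f : Y ⟶ X) (a b : X ⟶ Q.carrier) :
    f ≫ (a * b) = (f ≫ a) * (f ≫ b) := by
  rw [Hom.mul_def, Hom.mul_def, ← Category.assoc, comp_lift]

lemma comp_one' {X Y : C} (f : Y ⟶ X) : f ≫ (1 : X ⟶ Q.carrier) = 1 := by
  simp [Hom.one_def]

lemma mul_sup_le {X : C} (S : X ⟶ Pow Q.carrier) (d c : X ⟶ Q.carrier) :
    Q.Le (d * (S ≫ Q.sup)) c ↔ ∀ {Z : C} (f : Z ⟶ X) (b : Z ⟶ Q.carrier),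
      Holds (memP b (f ≫ S)) → Q.Le ((f ≫ d) * b) (f ≫ c) := by
  have e0 {Z : C} (f : Z ⟶ X) (b : Z ⟶ Q.carrier) :
    lift b f ≫ memP (fst Q.carrier X) (snd Q.carrier X ≫ S) = memP b (f ≫ S) := by
    unfold memP
    rw [← Category.assoc, comp_lift]
    simp
  have e1 {Z : C} (f : Z ⟶ X) (b : Z ⟶ Q.carrier) :
    lift b f ≫ lift (snd Q.carrier X ≫ d) (fst Q.carrier X) ≫ μ = (f ≫ d) * b := by
    rw [← Category.assoc, comp_lift]
    simp [Hom.mul_def]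
  rw [Hom.mul_def, Q.mul_sup]
  constructor
  · intro h Z f b hb
    refine Le.trans ?_ (h.comp f)
    have := mem_imageSet (memP (fst Q.carrier X) (snd Q.carrier X ≫ S))
      (lift (snd Q.carrier X ≫ d) (fst Q.carrier X) ≫ μ) f b (by rwa [e0])
    have := Q.le_sup _ _ this
    rw [e1] at this
    simpa [Le] using this
  · intro h
    refine Q.sup_le _ _ ?_
    intro Y f b hb
    refine imageSet_elim _ _ _ _ hb _ ?_
    intro W g y h1 h2
    rw [e0] at h1
    rw [e1] at h2
    have := h _ _ h1
    rw [← h2] at this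
    rw [← Category.assoc, comp_lift]
    simpa [Le] using this

/-- The subset of elements below `b`. -/
def down {X : C} (b : X ⟶ Q.carrier) : X ⟶ Pow Q.carrier :=
  MonoidalClosed.curry (lift (fst Q.carrier X) (snd Q.carrier X ≫ b) ≫ Q.le)

lemma mem_down {X Z : C} (b : X ⟶ Q.carrier) (f : Z ⟶ X) (a : Z ⟶ Q.carrier) :
    Holds (memP a (f ≫ down b)) ↔ Q.Le a (f ≫ b) := by
  unfold down
  rw [holds_memP_curry, ← Category.assoc, comp_lift]
  simp [Le]

lemma sup_down {X : C} (b : X ⟶ Q.carrier) : down b ≫ Q.sup = b := by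
  apply Q.le_antisymm
  · apply Q.sup_le
    intro Y f c hc
    rwa [mem_down] at hc
  · apply Q.le_sup
    have := (mem_down b (𝟙 X) b).2 (by simpa using Le.refl b)
    simpa using this

lemma mul_le_mul_left' {X : C} {a b : X ⟶ Q.carrier} (h : Q.Le a b) (d : X ⟶ Q.carrier) :
    Q.Le (d * a) (d * b) := by
  have := (mul_sup_le (down b) d (d * b)).1 (by rw [sup_down]; exact Le.refl _) (𝟙 X) a
    ((mem_down b (𝟙 X) a).2 (by simpa using h))
  simpa using this

lemma mul_join_le {X Y Z : C} (p : Y ⊗ X ⟶ HasSubobjectClassifier.Ω C) (t : Y ⊗ X ⟶ Q.carrier)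
    (f : Z ⟶ X) (d c : Z ⟶ Q.carrier) :
    Q.Le (d * (f ≫ Q.join p t)) c ↔ ∀ {W : C} (g : W ⟶ Z) (y : W ⟶ Y),
      Holds (lift y (g ≫ f) ≫ p) → Q.Le ((g ≫ d) * (lift y (g ≫ f) ≫ t)) (g ≫ c) := by
  unfold join
  rw [← Category.assoc, mul_sup_le]
  constructor
  · intro h W g y hy
    have := mem_imageSet p t (g ≫ f) y hy
    exact h g _ (by simpa using this)
  · intro h W g b hb
    have hb' : Holds (memP b ((g ≫ f) ≫ imageSet p t)) := by simpa using hb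
    refine imageSet_elim _ _ _ _ hb' _ ?_
    intro W' g' y h1 h2
    have := h (g' ≫ g) y (by simpa using h1)
    rw [← Category.assoc, comp_lift, comp_mul', h2]
    simpa [Le] using this

end

end InternalQuantale

/-! ## Relations with truth values in an internal quantale -/

namespace QRel

noncomputable section

open InternalQuantale

open scoped MonObj

variable {C : Type u} [Category.{v} C] [CartesianMonoidalCategory C]
  [HasFiniteLimits C] [MonoidalClosed C] [HasSubobjectClassifier C] {Q : InternalQuantale C}

/-- The truth value `R (a, b)`. -/
def app {A B X : C} (R : A ⊗ B ⟶ Q.carrier) (a : X ⟶ A) (b : X ⟶ B) : X ⟶ Q.carrier :=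
  lift a b ≫ R

variable (Q) in
/-- The graph of `f`: the relation `f_∘ (a, b) = ⋁ {k | f a = b}`. -/
def graph {A B : C} (f : A ⟶ B) : A ⊗ B ⟶ Q.carrier :=
  Q.join (Y := 𝟙_ C) (eqP (snd _ _ ≫ fst A B ≫ f) (snd _ _ ≫ snd A B)) (toUnit _ ≫ η)

/-- The composite relation: `(a, c) ↦ ⋁ {R (a, b) ⊗ S (b, c) | b : B}`. -/
def comp {A B D : C} (R : A ⊗ B ⟶ Q.carrier) (S : B ⊗ D ⟶ Q.carrier) : A ⊗ D ⟶ Q.carrier :=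
  Q.join (Y := B) (tt _)
    (app R (snd _ _ ≫ fst A D) (fst B (A ⊗ D)) * app S (fst B (A ⊗ D)) (snd _ _ ≫ snd A D))

/-- The tensor of relations: `((a, a'), (b, b')) ↦ R (a, b) ⊗ R' (a', b')`. -/
def tensor {A A' B B' : C} (R : A ⊗ B ⟶ Q.carrier) (R' : A' ⊗ B' ⟶ Q.carrier) :
    (A ⊗ A') ⊗ (B ⊗ B') ⟶ Q.carrier :=
  app R (fst _ _ ≫ fst A A') (snd _ _ ≫ fst B B') *
    app R' (fst _ _ ≫ snd A A') (snd _ _ ≫ snd B B')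

/-- The converse relation: `(b, a) ↦ R (a, b)`. -/
def converse {A B : C} (R : A ⊗ B ⟶ Q.carrier) : B ⊗ A ⟶ Q.carrier := app R (snd B A) (fst B A)

lemma ext' {A B : C} {R S : A ⊗ B ⟶ Q.carrier}
    (h : ∀ {X : C} (a : X ⟶ A) (b : X ⟶ B), app R a b = app S a b) : R = S := by
  simpa [app] using h (fst A B) (snd A B)

lemma comp_app {A B X Y : C} (R : A ⊗ B ⟶ Q.carrier) (f : Y ⟶ X) (a : X ⟶ A) (b : X ⟶ B) :
    f ≫ app R a b = app R (f ≫ a) (f ≫ b) := by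
  simp [app, ← Category.assoc, comp_lift]

lemma app_converse {A B X : C} (R : A ⊗ B ⟶ Q.carrier) (a : X ⟶ A) (b : X ⟶ B) :
    app (converse R) b a = app R a b := by
  change lift b a ≫ app R _ _ = _
  rw [comp_app]; simp

lemma app_tensor {A A' B B' X : C} (R : A ⊗ B ⟶ Q.carrier) (R' : A' ⊗ B' ⟶ Q.carrier)
    (a : X ⟶ A ⊗ A') (b : X ⟶ B ⊗ B') :
    app (tensor R R') a b =
      app R (a ≫ fst _ _) (b ≫ fst _ _) * app R' (a ≫ snd _ _) (b ≫ snd _ _) := by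
  change lift a b ≫ (app R _ _ * app R' _ _) = _
  rw [comp_mul', comp_app, comp_app]; simp

lemma mul_graph_le {A B X : C} (f : A ⟶ B) (a : X ⟶ A) (b : X ⟶ B) (d c : X ⟶ Q.carrier) :
    Q.Le (d * app (graph Q f) a b) c ↔ ∀ {Z : C} (g : Z ⟶ X), g ≫ a ≫ f = g ≫ b →
      Q.Le (g ≫ d) (g ≫ c) := by
  unfold graph
  conv_lhs => unfold app
  rw [mul_join_le]
  constructor
  · intro h Z g hg
    have := h g (toUnit _) (by rw [comp_eqP, holds_eqP]; simpa using hg)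
    rw [← Hom.one_def, comp_one', mul_one] at this
    exact this
  · intro h Z g y hg
    rw [← Hom.one_def, comp_one', mul_one]
    apply h
    rw [comp_eqP, holds_eqP] at hg
    simpa using hg

lemma mul_comp_le {A B D X : C} (R : A ⊗ B ⟶ Q.carrier) (S : B ⊗ D ⟶ Q.carrier)
    (a : X ⟶ A) (b : X ⟶ D) (d c : X ⟶ Q.carrier) :
    Q.Le (d * app (comp R S) a b) c ↔ ∀ {Z : C} (g : Z ⟶ X) (y : Z ⟶ B),
      Q.Le ((g ≫ d) * (app R (g ≫ a) y * app S y (g ≫ b))) (g ≫ c) := by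
  unfold comp
  conv_lhs => unfold app
  rw [mul_join_le]
  simp only [comp_mul']
  constructor
  · intro h Z g y
    have := h g y ((holds_tt _).comp _)
    simpa [app, ← Category.assoc, comp_lift] using this
  · intro h Z g y _
    have := h g y
    simpa [app, ← Category.assoc, comp_lift] using this

lemma graph_le {A B X : C} (f : A ⟶ B) (a : X ⟶ A) (b : X ⟶ B) (c : X ⟶ Q.carrier) :
    Q.Le (app (graph Q f) a b) c ↔ ∀ {Z : C} (g : Z ⟶ X), g ≫ a ≫ f = g ≫ b →
      Q.Le 1 (g ≫ c) := by
  have := mul_graph_le f a b 1 c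
  rw [one_mul] at this
  simpa only [comp_one'] using this

lemma comp_le {A B D X : C} (R : A ⊗ B ⟶ Q.carrier) (S : B ⊗ D ⟶ Q.carrier)
    (a : X ⟶ A) (b : X ⟶ D) (c : X ⟶ Q.carrier) :
    Q.Le (app (comp R S) a b) c ↔ ∀ {Z : C} (g : Z ⟶ X) (y : Z ⟶ B),
      Q.Le (app R (g ≫ a) y * app S y (g ≫ b)) (g ≫ c) := by
  have := mul_comp_le R S a b 1 c
  rw [one_mul] at this
  simpa only [comp_one', one_mul] using this

variable [BraidedCategory C] [IsCommMonObj Q.carrier]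

lemma app_graph_comp {A B D X : C} (f : A ⟶ B) (S : B ⊗ D ⟶ Q.carrier)
    (a : X ⟶ A) (b : X ⟶ D) : app (comp (graph Q f) S) a b = app S (a ≫ f) b := by
  apply eq_of_le_iff
  intro c
  rw [comp_le]
  constructor
  · intro h
    have := h (𝟙 X) (a ≫ f)
    rw [mul_comm, mul_graph_le] at this
    simpa using this (𝟙 X)
  · intro h Z g y
    rw [mul_comm, mul_graph_le]
    intro W k hk
    rw [comp_app, ← hk]
    simpa [comp_app] using h.comp (k ≫ g)

lemma app_comp_converse_graph {A B D X : C} (f : D ⟶ B) (R : A ⊗ B ⟶ Q.carrier)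
    (a : X ⟶ A) (b : X ⟶ D) :
    app (comp R (converse (graph Q f))) a b = app R a (b ≫ f) := by
  apply eq_of_le_iff
  intro c
  rw [comp_le]
  simp only [app_converse]
  constructor
  · intro h
    have := h (𝟙 X) (b ≫ f)
    rw [mul_graph_le] at this
    simpa using this (𝟙 X)
  · intro h Z g y
    rw [mul_graph_le]
    intro W k hk
    rw [comp_app, ← hk]
    simpa [comp_app] using h.comp (k ≫ g)

lemma app_graph_iso {A B X : C} (f : A ≅ B) (a : X ⟶ A) (b : X ⟶ B) :
    app (graph Q f.hom) a b = app (graph Q f.inv) b a := by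
  apply eq_of_le_iff
  intro c
  simp only [graph_le]
  refine ⟨fun h Z g hg => h g ?_, fun h Z g hg => h g ?_⟩
  · rw [← Category.assoc, ← hg]; simp
  · rw [← Category.assoc, ← hg]; simp

lemma graph_iso {A B : C} (f : A ≅ B) : graph Q f.hom = converse (graph Q f.inv) :=
  ext' fun a b => by rw [app_converse, app_graph_iso]

lemma app_comp_graph_iso {A B D X : C} (f : B ≅ D) (R : A ⊗ B ⟶ Q.carrier)
    (a : X ⟶ A) (b : X ⟶ D) : app (comp R (graph Q f.hom)) a b = app R a (b ≫ f.inv) := by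
  rw [graph_iso, app_comp_converse_graph]

lemma id_comp' {A B : C} (R : A ⊗ B ⟶ Q.carrier) : comp (graph Q (𝟙 A)) R = R :=
  ext' fun a b => by rw [app_graph_comp, Category.comp_id]

lemma comp_id' {A B : C} (R : A ⊗ B ⟶ Q.carrier) : comp R (graph Q (𝟙 B)) = R :=
  ext' fun a b => by
    have := app_comp_graph_iso (Iso.refl B) R a b
    simpa using this

lemma comp_assoc {A B D E : C} (R : A ⊗ B ⟶ Q.carrier) (S : B ⊗ D ⟶ Q.carrier)
    (T : D ⊗ E ⟶ Q.carrier) : comp (comp R S) T = comp R (comp S T) := by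
  refine ext' fun {X} a b => eq_of_le_iff fun c => ?_
  rw [comp_le, comp_le]
  constructor
  · intro h Z g y
    rw [mul_comp_le]
    intro W k x
    have := h (k ≫ g) x
    rw [mul_comm, mul_comp_le] at this
    have := this (𝟙 W) (k ≫ y)
    simp only [comp_app, Category.id_comp, Category.assoc] at this ⊢
    rwa [mul_comm, mul_assoc] at this
  · intro h Z g y
    rw [mul_comm, mul_comp_le]
    intro W k x
    have := h (k ≫ g) x
    rw [mul_comp_le] at this
    have := this (𝟙 W) (k ≫ y)
    simp only [comp_app, Category.id_comp, Category.assoc] at this ⊢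
    rwa [mul_comm, mul_assoc]

lemma graph_comp_graph {A B D : C} (f : A ⟶ B) (g : B ⟶ D) :
    comp (graph Q f) (graph Q g) = graph Q (f ≫ g) := by
  refine ext' fun {X} a b => ?_
  rw [app_graph_comp]
  apply eq_of_le_iff
  intro c
  simp only [graph_le, Category.assoc]

lemma tensor_graph {A A' B B' : C} (f : A ⟶ B) (g : A' ⟶ B') :
    tensor (graph Q f) (graph Q g) = graph Q (f ⊗ₘ g) := by
  refine ext' fun {X} a b => eq_of_le_iff fun c => ?_
  rw [app_tensor, mul_graph_le, graph_le]
  simp only [comp_app, graph_le]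
  constructor
  · intro h Z k hk
    have := h k (by simpa using hk =≫ snd _ _) (𝟙 Z) (by simpa using hk =≫ fst _ _)
    simpa using this
  · intro h Z k hk W l hl
    have := h (l ≫ k) (by
      ext
      · simpa using hl
      · simpa using l ≫= hk)
    simpa using this

lemma tensor_comp_tensor {A A' B B' D D' : C} (R : A ⊗ B ⟶ Q.carrier) (R' : A' ⊗ B' ⟶ Q.carrier)
    (S : B ⊗ D ⟶ Q.carrier) (S' : B' ⊗ D' ⟶ Q.carrier) :
    comp (tensor R R') (tensor S S') = tensor (comp R S) (comp R' S') := by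
  refine ext' fun {X} a b => eq_of_le_iff fun c => ?_
  rw [comp_le, app_tensor, mul_comp_le]
  simp only [app_tensor]
  constructor
  · intro h Z g y
    rw [comp_app, mul_comm, mul_comp_le]
    intro W k x
    have := h (k ≫ g) (lift x (k ≫ y))
    simp only [comp_mul', comp_app, Category.assoc, lift_fst, lift_snd] at this ⊢
    convert this using 1
    ac_rfl
  · intro h Z g y
    have := h g (y ≫ snd _ _)
    rw [comp_app, mul_comm, mul_comp_le] at this
    have := this (𝟙 Z) (y ≫ fst _ _)
    simp only [comp_mul', comp_app, Category.assoc, Category.id_comp] at this ⊢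
    convert this using 1
    ac_rfl

lemma comp_prod {X Z : C} (g : Z ⟶ X) {n : ℕ} (t : Fin n → (X ⟶ Q.carrier)) :
    g ≫ ∏ i, t i = ∏ i, g ≫ t i :=
  map_prod (MonoidHom.mk ⟨fun s : X ⟶ Q.carrier => g ≫ s, comp_one' g⟩ (comp_mul' g)) t Finset.univ

lemma mul_prod_graph_le {A B X : C} (f : A ⟶ B) (n : ℕ) (a : Fin n → (X ⟶ A))
    (b : Fin n → (X ⟶ B)) (d c : X ⟶ Q.carrier)
    (h : ∀ {Z : C} (g : Z ⟶ X), (∀ i, g ≫ a i ≫ f = g ≫ b i) → Q.Le (g ≫ d) (g ≫ c)) :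
    Q.Le (d * ∏ i, app (graph Q f) (a i) (b i)) c := by
  induction n generalizing X with
  | zero => simpa using h (𝟙 X) (fun i => i.elim0)
  | succ n ih =>
    rw [Fin.prod_univ_succ, mul_comm (app _ _ _), ← mul_assoc, mul_graph_le]
    intro Z g hg
    rw [comp_mul', comp_prod]
    simp only [comp_app]
    apply ih
    intro W k hk
    have := h (k ≫ g) (fun i => by
      refine Fin.cases ?_ (fun j => ?_) i
      · simpa using k ≫= hg
      · simpa using hk j)
    simpa using this

lemma mul_prod_comp_le {A B D X : C} (R : A ⊗ B ⟶ Q.carrier) (S : B ⊗ D ⟶ Q.carrier) (n : ℕ)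
    (a : Fin n → (X ⟶ A)) (b : Fin n → (X ⟶ D)) (d c : X ⟶ Q.carrier)
    (h : ∀ {Z : C} (g : Z ⟶ X) (y : Fin n → (Z ⟶ B)),
      Q.Le ((g ≫ d) * ∏ i, (app R (g ≫ a i) (y i) * app S (y i) (g ≫ b i))) (g ≫ c)) :
    Q.Le (d * ∏ i, app (comp R S) (a i) (b i)) c := by
  induction n generalizing X with
  | zero => simpa using h (𝟙 X) (fun i => i.elim0)
  | succ n ih =>
    rw [Fin.prod_univ_succ, mul_comm (app _ _ _), ← mul_assoc, mul_comp_le]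
    intro Z g y
    rw [comp_mul', comp_prod, mul_assoc, mul_comm (∏ i, _), ← mul_assoc]
    simp only [comp_app]
    apply ih
    intro W k x
    have := h (k ≫ g) (Fin.cons (k ≫ y) x)
    rw [Fin.prod_univ_succ, ← mul_assoc] at this
    simpa [comp_app, comp_mul'] using this

lemma natural_of_app {A B A' B' : C} (e : A ≅ B) (e' : A' ≅ B') (R : A ⊗ A' ⟶ Q.carrier)
    (S : B ⊗ B' ⟶ Q.carrier)
    (h : ∀ {X : C} (a : X ⟶ A) (b : X ⟶ B'), app R a (b ≫ e'.inv) = app S (a ≫ e.hom) b) :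
    comp R (graph Q e'.hom) = comp (graph Q e.hom) S :=
  ext' fun a b => by rw [app_comp_graph_iso, app_graph_comp, h]

lemma associator_nat {A A' B B' D D' : C} (R : A ⊗ A' ⟶ Q.carrier) (S : B ⊗ B' ⟶ Q.carrier)
    (T : D ⊗ D' ⟶ Q.carrier) :
    comp (tensor (tensor R S) T) (graph Q (α_ A' B' D').hom) =
      comp (graph Q (α_ A B D).hom) (tensor R (tensor S T)) :=
  natural_of_app _ _ _ _ fun a b => by simp [app_tensor, mul_assoc]

lemma leftUnitor_nat {A B : C} (R : A ⊗ B ⟶ Q.carrier) :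
    comp (tensor (graph Q (𝟙 (𝟙_ C))) R) (graph Q (λ_ B).hom) = comp (graph Q (λ_ A).hom) R :=
  natural_of_app _ _ _ _ fun a b => by
    rw [app_tensor]
    apply eq_of_le_iff
    intro c
    rw [mul_comm, mul_graph_le]
    refine ⟨fun h => ?_, fun h Z g _ => ?_⟩
    · simpa [leftUnitor_hom] using h (𝟙 _) (toUnit_unique _ _)
    · simpa [leftUnitor_hom] using h.comp g

lemma rightUnitor_nat {A B : C} (R : A ⊗ B ⟶ Q.carrier) :
    comp (tensor R (graph Q (𝟙 (𝟙_ C)))) (graph Q (ρ_ B).hom) = comp (graph Q (ρ_ A).hom) R :=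
  natural_of_app _ _ _ _ fun a b => by
    rw [app_tensor]
    apply eq_of_le_iff
    intro c
    rw [mul_graph_le]
    refine ⟨fun h => ?_, fun h Z g _ => ?_⟩
    · simpa [rightUnitor_hom] using h (𝟙 _) (toUnit_unique _ _)
    · simpa [rightUnitor_hom] using h.comp g

lemma braiding_nat {A A' B B' : C} (R : A ⊗ A' ⟶ Q.carrier) (S : B ⊗ B' ⟶ Q.carrier) :
    comp (tensor R S) (graph Q (β_ A' B').hom) = comp (graph Q (β_ A B).hom) (tensor S R) :=
  natural_of_app _ _ _ _ fun a b => by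
    rw [app_tensor, app_tensor, mul_comm]
    simp

end

end QRel

/-! ## Varieties and their algebras in a category with finite products -/

/-- An algebraic signature: a set of operation symbols of finite arity. -/
structure AlgSignature where
  /-- The operation symbols. -/
  Op : Type w
  /-- The arities. -/
  arity : Op → ℕ

/-- Terms over a signature in the variables `x₀, …, xₙ₋₁`. -/
inductive AlgSignature.Term (S : AlgSignature.{w}) (n : ℕ) : Type w
  | var : Fin n → AlgSignature.Term S n
  | app (σ : S.Op) : (Fin (S.arity σ) → AlgSignature.Term S n) → AlgSignature.Term S n

/-- A (presentation of a) variety: a signature and a set of equations between terms, each equation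
being stated in a finite context of variables. -/
structure AlgVariety extends AlgSignature.{w} where
  /-- The equations. -/
  eqns : Set (Σ n : ℕ, toAlgSignature.Term n × toAlgSignature.Term n)

namespace AlgVariety

noncomputable section

variable {C : Type u} [Category.{v} C] [CartesianMonoidalCategory C]

/-- The power `A ^ n`. -/
abbrev power (A : C) (n : ℕ) : C := ∏ᶜ fun _ : Fin n => A

/-- The interpretation `A ^ n ⟶ A` of a term. -/
def eval {S : AlgSignature.{w}} {A : C} (op : ∀ σ : S.Op, power A (S.arity σ) ⟶ A) {n : ℕ} :
    S.Term n → (power A n ⟶ A)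
  | .var i => Pi.π (fun _ : Fin n => A) i
  | .app σ ts => Pi.lift (fun j => eval op (ts j)) ≫ op σ

variable (V : AlgVariety.{w}) (C)

/-- Algebras of the variety `V` in `C`. -/
structure Alg where
  /-- The underlying object. -/
  carrier : C
  /-- The operations. -/
  op : ∀ σ : V.Op, power carrier (V.arity σ) ⟶ carrier
  sat : ∀ (n : ℕ) (s t : V.Term n), ⟨n, s, t⟩ ∈ V.eqns → eval op s = eval op t

namespace Alg

variable {V C}

/-- Homomorphisms of algebras. -/
@[ext]
structure Hom (A B : V.Alg C) where
  /-- The underlying morphism. -/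
  hom : A.carrier ⟶ B.carrier
  map_op : ∀ σ : V.Op, A.op σ ≫ hom = Limits.Pi.map (fun _ => hom) ≫ B.op σ

instance : Category (V.Alg C) where
  Hom A B := Hom A B
  id A := ⟨𝟙 _, fun σ => by simp⟩
  comp f g := ⟨f.hom ≫ g.hom, fun σ => by
    rw [← Category.assoc, f.map_op, Category.assoc, g.map_op, ← Category.assoc]
    congr 1
    ext; simp⟩

@[ext]
lemma ext_hom {A B : V.Alg C} {f g : A ⟶ B} (h : f.hom = g.hom) : f = g := Hom.ext h

@[simp]
lemma id_hom (A : V.Alg C) : Hom.hom (𝟙 A) = 𝟙 A.carrier := rfl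

@[simp]
lemma comp_hom {A B D : V.Alg C} (f : A ⟶ B) (g : B ⟶ D) : (f ≫ g).hom = f.hom ≫ g.hom := rfl

lemma lift_op {A B : V.Alg C} (f : A ⟶ B) (σ : V.Op) {X : C}
    (a : Fin (V.arity σ) → (X ⟶ A.carrier)) :
    (Pi.lift a ≫ A.op σ) ≫ f.hom = Pi.lift (fun i => a i ≫ f.hom) ≫ B.op σ := by
  rw [Category.assoc, f.map_op, ← Category.assoc]
  congr 1
  ext; simp

variable (C V) in
/-- The terminal algebra. -/
def unit : V.Alg C where
  carrier := 𝟙_ C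
  op _ := toUnit _
  sat _ _ _ _ := toUnit_unique _ _

/-- The componentwise operations on a product. -/
def prodOp (A B : V.Alg C) (σ : V.Op) :
    power (A.carrier ⊗ B.carrier) (V.arity σ) ⟶ A.carrier ⊗ B.carrier :=
  lift (Limits.Pi.map (fun _ => fst _ _) ≫ A.op σ) (Limits.Pi.map (fun _ => snd _ _) ≫ B.op σ)

lemma eval_prodOp (A B : V.Alg C) {n : ℕ} (t : V.Term n) :
    eval (prodOp A B) t =
      lift (Limits.Pi.map (fun _ => fst _ _) ≫ eval A.op t) (Limits.Pi.map (fun _ => snd _ _) ≫ eval B.op t) := by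
  induction t with
  | var i => ext <;> simp [eval]
  | app σ ts ih =>
    simp only [eval, prodOp, comp_lift, ← Category.assoc]
    congr 2
    · ext j; simp [ih]
    · ext j; simp [ih]

/-- The product of two algebras. -/
def prod (A B : V.Alg C) : V.Alg C where
  carrier := A.carrier ⊗ B.carrier
  op := prodOp A B
  sat n s t h := by rw [eval_prodOp, eval_prodOp, A.sat n s t h, B.sat n s t h]

/-- The first projection. -/
def prodFst (A B : V.Alg C) : prod A B ⟶ A where
  hom := fst _ _
  map_op σ := by simp [prod, prodOp]

/-- The second projection. -/
def prodSnd (A B : V.Alg C) : prod A B ⟶ B where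
  hom := snd _ _
  map_op σ := by simp [prod, prodOp]

/-- The pairing of two homomorphisms. -/
def prodLift {X A B : V.Alg C} (f : X ⟶ A) (g : X ⟶ B) : X ⟶ prod A B where
  hom := lift f.hom g.hom
  map_op σ := by
    change X.op σ ≫ lift f.hom g.hom =
      Limits.Pi.map (fun _ => lift f.hom g.hom) ≫ prodOp A B σ
    simp only [prodOp, comp_lift, ← Category.assoc, f.map_op, g.map_op]
    congr 2
    · ext; simp
    · ext; simp

/-- The category of algebras has finite products, computed on underlying objects. -/
instance : CartesianMonoidalCategory (V.Alg C) :=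
  .ofChosenFiniteProducts
    ⟨asEmptyCone (unit C V), IsTerminal.ofUniqueHom (fun A => ⟨toUnit _, fun _ => toUnit_unique _ _⟩)
      (fun _ _ => ext_hom (toUnit_unique _ _))⟩
    (fun A B => ⟨BinaryFan.mk (prodFst A B) (prodSnd A B), BinaryFan.isLimitMk
      (fun s => prodLift s.fst s.snd)
      (fun s => ext_hom (lift_fst _ _)) (fun s => ext_hom (lift_snd _ _))
      (fun s m h1 h2 => ext_hom (by
        apply CartesianMonoidalCategory.hom_ext
        · exact (congrArg Hom.hom h1).trans (lift_fst _ _).symm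
        · exact (congrArg Hom.hom h2).trans (lift_snd _ _).symm))⟩)

instance : BraidedCategory (V.Alg C) := .ofCartesianMonoidalCategory

lemma tensor_carrier (A B : V.Alg C) : (A ⊗ B).carrier = A.carrier ⊗ B.carrier := rfl

lemma fst_hom (A B : V.Alg C) : (fst A B).hom = fst A.carrier B.carrier := rfl

lemma snd_hom (A B : V.Alg C) : (snd A B).hom = snd A.carrier B.carrier := rfl

lemma lift_hom {X A B : V.Alg C} (f : X ⟶ A) (g : X ⟶ B) :
    (lift f g).hom = lift f.hom g.hom := by
  apply CartesianMonoidalCategory.hom_ext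
  · exact (congrArg Hom.hom (lift_fst f g)).trans (lift_fst _ _).symm
  · exact (congrArg Hom.hom (lift_snd f g)).trans (lift_snd _ _).symm

lemma associator_hom (A B D : V.Alg C) :
    (α_ A B D).hom.hom = (α_ A.carrier B.carrier D.carrier).hom := by
  apply CartesianMonoidalCategory.hom_ext
  · exact (congrArg Hom.hom (associator_hom_fst A B D)).trans (associator_hom_fst _ _ _).symm
  · apply CartesianMonoidalCategory.hom_ext
    · exact (Category.assoc _ _ _).trans <|
        (congrArg Hom.hom (associator_hom_snd_fst A B D)).trans
        ((Category.assoc _ _ _).trans (associator_hom_snd_fst _ _ _)).symm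
    · exact (Category.assoc _ _ _).trans <|
        (congrArg Hom.hom (associator_hom_snd_snd A B D)).trans
        ((Category.assoc _ _ _).trans (associator_hom_snd_snd _ _ _)).symm

lemma leftUnitor_hom' (A : V.Alg C) : (λ_ A).hom.hom = (λ_ A.carrier).hom := by
  rw [leftUnitor_hom, leftUnitor_hom]; rfl

lemma rightUnitor_hom' (A : V.Alg C) : (ρ_ A).hom.hom = (ρ_ A.carrier).hom := by
  rw [rightUnitor_hom, rightUnitor_hom]; rfl

lemma braiding_hom' [BraidedCategory C] (A B : V.Alg C) :
    (β_ A B).hom.hom = (β_ A.carrier B.carrier).hom := by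
  apply CartesianMonoidalCategory.hom_ext
  · exact (congrArg Hom.hom (braiding_hom_fst A B)).trans (braiding_hom_fst _ _).symm
  · exact (congrArg Hom.hom (braiding_hom_snd A B)).trans (braiding_hom_snd _ _).symm

end Alg

end

end AlgVariety

/-! ## The category of algebraic relations -/

/-- The objects of the category `Rel_V(Q)`: algebras of the variety `V` in the topos `C`. -/
structure RelAlg {C : Type u} [Category.{v} C] [CartesianMonoidalCategory C] [HasFiniteLimits C]
    [MonoidalClosed C] [HasSubobjectClassifier C] (V : AlgVariety.{w}) (Q : InternalQuantale C) where
  /-- The algebra. -/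
  alg : V.Alg C

namespace RelAlg

noncomputable section

open InternalQuantale QRel

open scoped MonObj

variable {C : Type u} [Category.{v} C] [CartesianMonoidalCategory C] [BraidedCategory C]
  [HasFiniteLimits C] [MonoidalClosed C] [HasSubobjectClassifier C] {V : AlgVariety.{w}}
  {Q : InternalQuantale C} [IsCommMonObj Q.carrier]

/-- The relation `R` is algebraic if
`R (a₁, b₁) ⊗ … ⊗ R (aₙ, bₙ) ≤ R (σ (a₁, …, aₙ), σ (b₁, …, bₙ))` for every operation `σ`. -/
def IsAlgebraic (A B : V.Alg C) (R : A.carrier ⊗ B.carrier ⟶ Q.carrier) : Prop :=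
  ∀ (σ : V.Op) {X : C} (a : Fin (V.arity σ) → (X ⟶ A.carrier))
    (b : Fin (V.arity σ) → (X ⟶ B.carrier)),
    Q.Le (∏ i, app R (a i) (b i)) (app R (Pi.lift a ≫ A.op σ) (Pi.lift b ≫ B.op σ))

lemma isAlgebraic_graph {A B : V.Alg C} (f : A ⟶ B) : IsAlgebraic A B (graph Q f.hom) := by
  intro σ X a b
  rw [← one_mul (∏ i, _)]
  apply mul_prod_graph_le
  intro Z g hg
  have h := (graph_le f.hom (g ≫ Pi.lift a ≫ A.op σ) (g ≫ Pi.lift b ≫ B.op σ)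
    (app (graph Q f.hom) (g ≫ Pi.lift a ≫ A.op σ) (g ≫ Pi.lift b ≫ B.op σ))).1 (Le.refl _) (𝟙 Z)
  rw [comp_one', comp_app]
  simp only [Category.id_comp] at h
  apply h
  rw [Category.assoc, AlgVariety.Alg.lift_op, ← Category.assoc, ← Category.assoc]
  congr 1
  ext i
  simpa using hg i

lemma le_comp {A B D X : C} (R : A ⊗ B ⟶ Q.carrier) (S : B ⊗ D ⟶ Q.carrier) (a : X ⟶ A)
    (b : X ⟶ B) (d : X ⟶ D) : Q.Le (app R a b * app S b d) (app (comp R S) a d) := by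
  have := (comp_le R S a d (app (comp R S) a d)).1 (Le.refl _) (𝟙 X) b
  simpa using this

lemma mul_mono {X : C} {a b c d : X ⟶ Q.carrier} (h : Q.Le a b) (h' : Q.Le c d) :
    Q.Le (a * c) (b * d) := by
  refine (mul_le_mul_left' h' a).trans ?_
  rw [mul_comm a, mul_comm b]
  exact mul_le_mul_left' h d

lemma isAlgebraic_comp {A B D : V.Alg C} {R : A.carrier ⊗ B.carrier ⟶ Q.carrier}
    {S : B.carrier ⊗ D.carrier ⟶ Q.carrier} (hR : IsAlgebraic A B R) (hS : IsAlgebraic B D S) :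
    IsAlgebraic A D (comp R S) := by
  intro σ X a b
  rw [← one_mul (∏ i, _)]
  apply mul_prod_comp_le
  intro Z g y
  rw [comp_one', one_mul, Finset.prod_mul_distrib]
  refine (mul_mono (hR σ _ _) (hS σ _ _)).trans ((le_comp _ _ _ _ _).trans ?_)
  rw [comp_app, ← Category.assoc, ← Category.assoc]
  convert Le.refl _ using 4 <;> ext <;> simp

lemma isAlgebraic_converse {A B : V.Alg C} {R : A.carrier ⊗ B.carrier ⟶ Q.carrier}
    (hR : IsAlgebraic A B R) : IsAlgebraic B A (converse R) := by
  intro σ X a b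
  simp only [app_converse]
  exact hR σ b a

lemma isAlgebraic_tensor {A A' B B' : V.Alg C} {R : A.carrier ⊗ B.carrier ⟶ Q.carrier}
    {R' : A'.carrier ⊗ B'.carrier ⟶ Q.carrier} (hR : IsAlgebraic A B R)
    (hR' : IsAlgebraic A' B' R') : IsAlgebraic (A ⊗ A') (B ⊗ B') (tensor R R') := by
  intro σ X a b
  have e1 (A A' : V.Alg C) (a : Fin (V.arity σ) → (X ⟶ A.carrier ⊗ A'.carrier)) :
      (Pi.lift a ≫ (A ⊗ A').op σ) ≫ fst A.carrier A'.carrier =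
        Pi.lift (fun i => a i ≫ fst _ _) ≫ A.op σ := AlgVariety.Alg.lift_op (fst A A') σ a
  have e2 (A A' : V.Alg C) (a : Fin (V.arity σ) → (X ⟶ A.carrier ⊗ A'.carrier)) :
      (Pi.lift a ≫ (A ⊗ A').op σ) ≫ snd A.carrier A'.carrier =
        Pi.lift (fun i => a i ≫ snd _ _) ≫ A'.op σ := AlgVariety.Alg.lift_op (snd A A') σ a
  have e3 := (app_tensor R R' (Pi.lift a ≫ (A ⊗ A').op σ) (Pi.lift b ≫ (B ⊗ B').op σ)).trans
    (congrArg₂ (· * ·) (congrArg₂ (app R) (e1 A A' a) (e1 B B' b))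
      (congrArg₂ (app R') (e2 A A' a) (e2 B B' b)))
  have e4 : ∏ i, app (tensor R R') (a i) (b i) =
      (∏ i, app R (a i ≫ fst _ _) (b i ≫ fst _ _)) *
        ∏ i, app R' (a i ≫ snd _ _) (b i ≫ snd _ _) := by
    rw [← Finset.prod_mul_distrib]
    exact Finset.prod_congr rfl fun i _ => app_tensor R R' (a i) (b i)
  have := mul_mono (hR σ (fun i => a i ≫ fst _ _) (fun i => b i ≫ fst _ _))
    (hR' σ (fun i => a i ≫ snd _ _) (fun i => b i ≫ snd _ _))
  exact (e4 ▸ e3 ▸ this :)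

/-- The morphisms of `Rel_V(Q)`: algebraic `Q`-relations. -/
@[ext]
structure Hom (A B : RelAlg V Q) where
  /-- The underlying `Q`-relation. -/
  rel : A.alg.carrier ⊗ B.alg.carrier ⟶ Q.carrier
  isAlgebraic : IsAlgebraic A.alg B.alg rel

/-- The category `Rel_V(Q)`. The identity on `A` is `(a₁, a₂) ↦ ⋁ {k | a₁ = a₂}`. -/
instance : Category (RelAlg V Q) where
  Hom A B := Hom A B
  id A := ⟨graph Q (𝟙 A.alg.carrier), isAlgebraic_graph (𝟙 A.alg)⟩
  comp R S := ⟨comp R.rel S.rel, isAlgebraic_comp R.isAlgebraic S.isAlgebraic⟩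
  id_comp R := Hom.ext (id_comp' R.rel)
  comp_id R := Hom.ext (comp_id' R.rel)
  assoc R S T := Hom.ext (comp_assoc R.rel S.rel T.rel)

lemma ext_rel {A B : RelAlg V Q} {R S : A ⟶ B} (h : R.rel = S.rel) : R = S := Hom.ext h

lemma comp_rel {A B D : RelAlg V Q} (R : A ⟶ B) (S : B ⟶ D) :
    (R ≫ S).rel = comp R.rel S.rel := rfl

lemma id_rel (A : RelAlg V Q) : Hom.rel (𝟙 A) = graph Q (𝟙 A.alg.carrier) := rfl

variable (V Q) in
/-- The graph functor from algebras and homomorphisms to algebras and algebraic `Q`-relations. -/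
def graphFunctor : V.Alg C ⥤ RelAlg V Q where
  obj A := ⟨A⟩
  map f := ⟨graph Q f.hom, isAlgebraic_graph f⟩
  map_id _ := rfl
  map_comp f g := ext_rel (graph_comp_graph f.hom g.hom).symm

/-- The converse of an algebraic `Q`-relation. -/
def conv {A B : RelAlg V Q} (R : A ⟶ B) : B ⟶ A :=
  ⟨converse R.rel, isAlgebraic_converse R.isAlgebraic⟩

/-- The tensor product is the product of algebras on objects and the pointwise tensor on
relations; the coherence isomorphisms are the graphs of those of the finite product structure on
algebras. -/
instance : MonoidalCategoryStruct (RelAlg V Q) where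
  tensorObj A B := ⟨A.alg ⊗ B.alg⟩
  tensorUnit := ⟨𝟙_ (V.Alg C)⟩
  tensorHom R S := ⟨tensor R.rel S.rel, isAlgebraic_tensor R.isAlgebraic S.isAlgebraic⟩
  whiskerLeft A _ _ S := ⟨tensor (Hom.rel (𝟙 A)) S.rel,
    isAlgebraic_tensor (Hom.isAlgebraic (𝟙 A)) S.isAlgebraic⟩
  whiskerRight R B := ⟨tensor R.rel (Hom.rel (𝟙 B)),
    isAlgebraic_tensor R.isAlgebraic (Hom.isAlgebraic (𝟙 B))⟩
  associator A B D := (graphFunctor V Q).mapIso (α_ A.alg B.alg D.alg)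
  leftUnitor A := (graphFunctor V Q).mapIso (λ_ A.alg)
  rightUnitor A := (graphFunctor V Q).mapIso (ρ_ A.alg)

lemma graph_tensor {A A' B B' : V.Alg C} (f : A ⟶ B) (g : A' ⟶ B') :
    (graphFunctor V Q).map f ⊗ₘ (graphFunctor V Q).map g = (graphFunctor V Q).map (f ⊗ₘ g) := by
  apply ext_rel
  have e : (f ⊗ₘ g).hom = f.hom ⊗ₘ g.hom := by
    apply CartesianMonoidalCategory.hom_ext
    · exact (congrArg AlgVariety.Alg.Hom.hom (tensorHom_fst f g)).trans (tensorHom_fst _ _).symm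
    · exact (congrArg AlgVariety.Alg.Hom.hom (tensorHom_snd f g)).trans (tensorHom_snd _ _).symm
  change tensor (graph Q f.hom) (graph Q g.hom) = graph Q (f ⊗ₘ g).hom
  exact (tensor_graph _ _).trans (congrArg (graph Q) e.symm)


/-- `Rel_V(Q)` is a monoidal category. -/
instance : MonoidalCategory (RelAlg V Q) := .ofTensorHom
  (id_tensorHom_id := fun A B => (graph_tensor (𝟙 A.alg) (𝟙 B.alg)).trans (by simp; rfl))
  (id_tensorHom := fun _ _ _ _ => rfl)
  (tensorHom_id := fun _ _ => rfl)
  (tensorHom_comp_tensorHom := fun R R' S S' =>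
    ext_rel (tensor_comp_tensor R.rel R'.rel S.rel S'.rel))
  (associator_naturality := fun {A B D A' B' D'} R S T => ext_rel (by
    change comp _ (graph Q (α_ A'.alg B'.alg D'.alg).hom.hom) =
      comp (graph Q (α_ A.alg B.alg D.alg).hom.hom) _
    rw [AlgVariety.Alg.associator_hom, AlgVariety.Alg.associator_hom]
    exact associator_nat R.rel S.rel T.rel))
  (leftUnitor_naturality := fun {A B} R => ext_rel (by
    change comp _ (graph Q (λ_ B.alg).hom.hom) = comp (graph Q (λ_ A.alg).hom.hom) _
    rw [AlgVariety.Alg.leftUnitor_hom', AlgVariety.Alg.leftUnitor_hom']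
    exact leftUnitor_nat R.rel))
  (rightUnitor_naturality := fun {A B} R => ext_rel (by
    change comp _ (graph Q (ρ_ B.alg).hom.hom) = comp (graph Q (ρ_ A.alg).hom.hom) _
    rw [AlgVariety.Alg.rightUnitor_hom', AlgVariety.Alg.rightUnitor_hom']
    exact rightUnitor_nat R.rel))
  (pentagon := fun A B D E => by
    change ((graphFunctor V Q).map _ ⊗ₘ (graphFunctor V Q).map (𝟙 E.alg)) ≫
      (graphFunctor V Q).map _ ≫ ((graphFunctor V Q).map (𝟙 A.alg) ⊗ₘ (graphFunctor V Q).map _) =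
      (graphFunctor V Q).map _ ≫ (graphFunctor V Q).map _
    rw [graph_tensor, graph_tensor]
    have := congrArg (graphFunctor V Q).map (MonoidalCategory.pentagon A.alg B.alg D.alg E.alg)
    rw [← tensorHom_id, ← id_tensorHom] at this
    simp only [Functor.map_comp] at this
    exact this)
  (triangle := fun A B => by
    change (graphFunctor V Q).map _ ≫
      ((graphFunctor V Q).map (𝟙 A.alg) ⊗ₘ (graphFunctor V Q).map _) =
      ((graphFunctor V Q).map _ ⊗ₘ (graphFunctor V Q).map (𝟙 B.alg))
    rw [graph_tensor, graph_tensor]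
    have := congrArg (graphFunctor V Q).map (MonoidalCategory.triangle A.alg B.alg)
    rw [← tensorHom_id, ← id_tensorHom] at this
    simp only [Functor.map_comp] at this
    exact this)

lemma braiding_natural {A A' B B' : RelAlg V Q} (R : A ⟶ A') (S : B ⟶ B') :
    (R ⊗ₘ S) ≫ (graphFunctor V Q).map (β_ A'.alg B'.alg).hom =
      ((graphFunctor V Q).map (β_ A.alg B.alg).hom ≫ (S ⊗ₘ R) : A ⊗ B ⟶ B' ⊗ A') := ext_rel (by
  change comp _ (graph Q (β_ A'.alg B'.alg).hom.hom) = comp (graph Q (β_ A.alg B.alg).hom.hom) _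
  rw [AlgVariety.Alg.braiding_hom', AlgVariety.Alg.braiding_hom']
  exact braiding_nat R.rel S.rel)

/-- `Rel_V(Q)` is a symmetric monoidal category, the symmetry being the graph of the symmetry of
the finite product structure on algebras. -/
instance : SymmetricCategory (RelAlg V Q) where
  braiding A B := (graphFunctor V Q).mapIso (β_ A.alg B.alg)
  braiding_naturality_right A _ _ S := by
    rw [← id_tensorHom, ← tensorHom_id]
    exact braiding_natural (𝟙 A) S
  braiding_naturality_left R B := by
    rw [← id_tensorHom, ← tensorHom_id]
    exact braiding_natural R (𝟙 B)
  hexagon_forward A B D := by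
    rw [← tensorHom_id, ← id_tensorHom]
    change (graphFunctor V Q).map _ ≫ (graphFunctor V Q).map _ ≫ (graphFunctor V Q).map _ =
      ((graphFunctor V Q).map _ ⊗ₘ (graphFunctor V Q).map (𝟙 D.alg)) ≫ (graphFunctor V Q).map _ ≫
      ((graphFunctor V Q).map (𝟙 B.alg) ⊗ₘ (graphFunctor V Q).map _)
    rw [graph_tensor, graph_tensor]
    have := congrArg (graphFunctor V Q).map
      (BraidedCategory.hexagon_forward A.alg B.alg D.alg)
    rw [← tensorHom_id, ← id_tensorHom] at this
    simp only [Functor.map_comp] at this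
    exact this
  hexagon_reverse A B D := by
    rw [← tensorHom_id, ← id_tensorHom]
    change (graphFunctor V Q).map _ ≫ (graphFunctor V Q).map _ ≫ (graphFunctor V Q).map _ =
      ((graphFunctor V Q).map (𝟙 A.alg) ⊗ₘ (graphFunctor V Q).map _) ≫ (graphFunctor V Q).map _ ≫
      ((graphFunctor V Q).map _ ⊗ₘ (graphFunctor V Q).map (𝟙 B.alg))
    rw [graph_tensor, graph_tensor]
    have := congrArg (graphFunctor V Q).map
      (BraidedCategory.hexagon_reverse A.alg B.alg D.alg)
    rw [← tensorHom_id, ← id_tensorHom] at this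
    simp only [Functor.map_comp] at this
    exact this
  symmetry A B := by
    change (graphFunctor V Q).map _ ≫ (graphFunctor V Q).map _ = _
    rw [← Functor.map_comp, SymmetricCategory.symmetry]
    exact (graphFunctor V Q).map_id _

end

end RelAlg

/-! ## Hypergraph categories -/

open scoped MonObj ComonObj in
/-- A hypergraph category: a symmetric monoidal category with a chosen special commutative
Frobenius algebra structure on every object, coherent with the tensor product. -/
class HypergraphCategory (D : Type u) [Category.{v} D] [MonoidalCategory D]
    [SymmetricCategory D] where
  /-- The monoid structure on an object. -/
  mon (A : D) : MonObj A
  /-- The comonoid structure on an object. -/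
  comon (A : D) : ComonObj A
  mon_comm (A : D) : IsCommMonObj A
  comon_comm (A : D) : IsCommComonObj A
  comul_tensor (A B : D) : (comon (A ⊗ B)).comul = (Δ[A] ⊗ₘ Δ[B]) ≫ tensorμ A A B B
  counit_tensor (A B : D) : (comon (A ⊗ B)).counit = (ε[A] ⊗ₘ ε[B]) ≫ (λ_ (𝟙_ D)).hom
  mul_tensor (A B : D) : (mon (A ⊗ B)).mul = tensorμ A B A B ≫ (μ[A] ⊗ₘ μ[B])
  one_tensor (A B : D) : (mon (A ⊗ B)).one = (λ_ (𝟙_ D)).inv ≫ (η[A] ⊗ₘ η[B])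
  frobenius_left (A : D) : (A ◁ Δ[A]) ≫ (α_ A A A).inv ≫ (μ[A] ▷ A) = μ[A] ≫ Δ[A]
  frobenius_right (A : D) : (Δ[A] ▷ A) ≫ (α_ A A A).hom ≫ (A ◁ μ[A]) = μ[A] ≫ Δ[A]
  special (A : D) : Δ[A] ≫ μ[A] = 𝟙 A

/-! The converse makes algebraic relations into a dagger symmetric monoidal category, and taking
graphs is a strict symmetric monoidal functor that carries the cartesian comonoid of an algebra to
the comonoid of the theorem. The monoids are the daggers of these comonoids, so their laws and
their coherence with the tensor product come for free. The Frobenius and special equations are both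
instances of the Beck–Chevalley condition `q ∘ p° = h° ∘ f` for graphs of a pullback square
`f ∘ p = h ∘ q`: for the Frobenius equation the square consists of diagonals and expresses that
`(x, x, y) = (z, w, w)` forces `x = y = z = w`, and for the special equation it is the kernel pair
of the diagonal, which is trivial since the diagonal is monic. -/

/-- A dagger symmetric monoidal category: a symmetric monoidal category with an involutive,
identity-on-objects, contravariant symmetric monoidal functor whose coherence isomorphisms are
unitary. Unitarity of the right unitor is not a field since it follows from that of the left
unitor and the braiding. -/
class DaggerSymmetricCategory (D : Type u) [Category.{v} D] [MonoidalCategory D]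
    [SymmetricCategory D] where
  /-- The adjoint of a morphism. -/
  dagger {A B : D} (f : A ⟶ B) : B ⟶ A
  dagger_comp {A B E : D} (f : A ⟶ B) (g : B ⟶ E) : dagger (f ≫ g) = dagger g ≫ dagger f
  dagger_dagger {A B : D} (f : A ⟶ B) : dagger (dagger f) = f
  dagger_tensorHom {A A' B B' : D} (f : A ⟶ B) (g : A' ⟶ B') :
    dagger (f ⊗ₘ g) = dagger f ⊗ₘ dagger g
  dagger_associator_hom (A B E : D) : dagger (α_ A B E).hom = (α_ A B E).inv
  dagger_leftUnitor_hom (A : D) : dagger (λ_ A).hom = (λ_ A).inv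
  dagger_braiding_hom (A B : D) : dagger (β_ A B).hom = (β_ A B).inv

namespace DaggerSymmetricCategory

open scoped ComonObj

section

variable {D : Type u} [Category.{v} D] [MonoidalCategory D] [SymmetricCategory D]
  [DaggerSymmetricCategory D]

lemma dagger_id (A : D) : dagger (𝟙 A) = 𝟙 A := by
  have h : dagger (dagger (𝟙 A) ≫ 𝟙 A) = dagger (𝟙 A) := by
    rw [dagger_comp, dagger_dagger, Category.comp_id]
  rwa [Category.comp_id, dagger_dagger, eq_comm] at h

lemma dagger_whiskerLeft (A : D) {B E : D} (f : B ⟶ E) : dagger (A ◁ f) = A ◁ dagger f := by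
  rw [← id_tensorHom, dagger_tensorHom, dagger_id, id_tensorHom]

lemma dagger_whiskerRight {A B : D} (f : A ⟶ B) (E : D) : dagger (f ▷ E) = dagger f ▷ E := by
  rw [← tensorHom_id, dagger_tensorHom, dagger_id, tensorHom_id]

lemma dagger_associator_inv (A B E : D) : dagger (α_ A B E).inv = (α_ A B E).hom := by
  rw [← dagger_associator_hom, dagger_dagger]

lemma dagger_leftUnitor_inv (A : D) : dagger (λ_ A).inv = (λ_ A).hom := by
  rw [← dagger_leftUnitor_hom, dagger_dagger]

lemma dagger_rightUnitor_inv (A : D) : dagger (ρ_ A).inv = (ρ_ A).hom := by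
  rw [← leftUnitor_inv_braiding, dagger_comp, dagger_braiding_hom, dagger_leftUnitor_inv,
    ← SymmetricCategory.braiding_swap_eq_inv_braiding, braiding_leftUnitor]

lemma dagger_tensorμ (A₁ A₂ B₁ B₂ : D) :
    dagger (tensorμ A₁ A₂ B₁ B₂) = tensorμ A₁ B₁ A₂ B₂ := by
  simp only [tensorμ, dagger_comp, dagger_whiskerLeft, dagger_whiskerRight, dagger_associator_hom,
    dagger_associator_inv, dagger_braiding_hom, Category.assoc,
    ← SymmetricCategory.braiding_swap_eq_inv_braiding]

/-- The dagger of a comonoid is a monoid on the same object. -/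
abbrev monObjOfComonObj (A : D) [ComonObj A] : MonObj A where
  one := dagger ε[A]
  mul := dagger Δ[A]
  one_mul := by
    rw [← dagger_whiskerRight, ← dagger_comp, ComonObj.counit_comul, dagger_leftUnitor_inv]
  mul_one := by
    rw [← dagger_whiskerLeft, ← dagger_comp, ComonObj.comul_counit, dagger_rightUnitor_inv]
  mul_assoc := by
    rw [← dagger_whiskerLeft, ← dagger_whiskerRight, ← dagger_associator_inv]
    simp only [← dagger_comp, ComonObj.comul_assoc, Category.assoc, Iso.hom_inv_id,
      Category.comp_id]

lemma frobenius_left_of_frobenius_right {A : D} [ComonObj A]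
    (frobenius : Δ[A] ▷ A ≫ (α_ A A A).hom ≫ A ◁ dagger Δ[A] = dagger Δ[A] ≫ Δ[A]) :
    A ◁ Δ[A] ≫ (α_ A A A).inv ≫ dagger Δ[A] ▷ A = dagger Δ[A] ≫ Δ[A] := by
  simpa only [dagger_comp, dagger_whiskerLeft, dagger_whiskerRight, dagger_dagger,
    dagger_associator_hom, Category.assoc] using congrArg dagger frobenius

attribute [local instance] monObjOfComonObj

lemma isCommMonObj_of_isCommComonObj (A : D) [ComonObj A] [IsCommComonObj A] :
    IsCommMonObj A where
  mul_comm := by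
    change (β_ A A).hom ≫ dagger Δ[A] = dagger Δ[A]
    rw [SymmetricCategory.braiding_swap_eq_inv_braiding, ← dagger_braiding_hom, ← dagger_comp,
      IsCommComonObj.comul_comm]

end

variable {D : Type u} [Category.{v} D] [MonoidalCategory D] [CopyDiscardCategory D]
  [DaggerSymmetricCategory D]

/-- A dagger copy-discard category whose copy maps are isometries satisfying the Frobenius law is
a hypergraph category: the monoids are the daggers of the comonoids. -/
abbrev hypergraphCategory
    (frobenius : ∀ A : D, Δ[A] ▷ A ≫ (α_ A A A).hom ≫ A ◁ dagger Δ[A] = dagger Δ[A] ≫ Δ[A])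
    (special : ∀ A : D, Δ[A] ≫ dagger Δ[A] = 𝟙 A) : HypergraphCategory D where
  mon A := monObjOfComonObj A
  comon A := inferInstance
  mon_comm A := isCommMonObj_of_isCommComonObj A
  comon_comm A := inferInstance
  comul_tensor := CopyDiscardCategory.copy_tensor
  counit_tensor := CopyDiscardCategory.discard_tensor
  mul_tensor A B := by
    refine (congrArg dagger (CopyDiscardCategory.copy_tensor A B)).trans ?_
    rw [dagger_comp, dagger_tensorHom, dagger_tensorμ]
    rfl
  one_tensor A B := by
    refine (congrArg dagger (CopyDiscardCategory.discard_tensor A B)).trans ?_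
    rw [dagger_comp, dagger_tensorHom, dagger_leftUnitor_hom]
    rfl
  frobenius_left A := frobenius_left_of_frobenius_right (frobenius A)
  frobenius_right := frobenius
  special := special

end DaggerSymmetricCategory

lemma isPullback_diag_diag {C : Type u} [Category.{v} C] [CartesianMonoidalCategory C] (A : C) :
    IsPullback (lift (𝟙 A) (𝟙 A)) (lift (𝟙 A) (𝟙 A))
      (lift (𝟙 A) (𝟙 A) ▷ A ≫ (α_ A A A).hom) (A ◁ lift (𝟙 A) (𝟙 A)) := by
  refine .mk' (by ext <;> simp) (fun _ φ φ' h _ => ?_) (fun T a b h => ?_)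
  · simpa using h =≫ fst A A
  have fst_eq := h =≫ fst _ _
  have snd_fst_eq := h =≫ (snd _ _ ≫ fst _ _)
  have snd_snd_eq := h =≫ (snd _ _ ≫ snd _ _)
  simp only [Category.assoc, associator_hom_fst, associator_hom_snd_fst, associator_hom_snd_snd,
    whiskerRight_fst_assoc, whiskerRight_snd, whiskerLeft_fst, whiskerLeft_snd_assoc, lift_fst,
    lift_snd, Category.comp_id] at fst_eq snd_fst_eq snd_snd_eq
  exact ⟨a ≫ fst A A, by ext <;> simp [snd_fst_eq, snd_snd_eq],
    by ext <;> simp [fst_eq, ← snd_fst_eq]⟩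

namespace QRel

open InternalQuantale

open scoped MonObj

variable {C : Type u} [Category.{v} C] [CartesianMonoidalCategory C] [HasFiniteLimits C]
  [MonoidalClosed C] [HasSubobjectClassifier C] {Q : InternalQuantale C}

lemma converse_converse {A B : C} (R : A ⊗ B ⟶ Q.carrier) : converse (converse R) = R :=
  ext' fun a b => by rw [app_converse, app_converse]

lemma converse_tensor {A A' B B' : C} (R : A ⊗ B ⟶ Q.carrier) (R' : A' ⊗ B' ⟶ Q.carrier) :
    converse (tensor R R') = tensor (converse R) (converse R') :=
  ext' fun a b => by simp only [app_converse, app_tensor]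

lemma converse_graph_comp_graph_le {P A B X : C} (p : P ⟶ A) (q : P ⟶ B) (a : X ⟶ A)
    (b : X ⟶ B) (c : X ⟶ Q.carrier) :
    Q.Le (app (comp (converse (graph Q p)) (graph Q q)) a b) c ↔
      ∀ {Z : C} (g : Z ⟶ X) (y : Z ⟶ P), y ≫ p = g ≫ a → y ≫ q = g ≫ b → Q.Le 1 (g ≫ c) := by
  simp only [comp_le, app_converse, mul_graph_le, comp_app, graph_le]
  constructor
  · intro h Z g y hp hq
    simpa using h g y (𝟙 Z) (by simpa using hq) (𝟙 Z) (by simpa using hp)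
  · intro h Z g y W k hq U l hp
    simpa using h (l ≫ k ≫ g) (l ≫ k ≫ y) (by simpa using hp) (by simpa using l ≫= hq)

variable [BraidedCategory C] [IsCommMonObj Q.carrier]

lemma graph_comp_converse_graph_le {A B D X : C} (f : A ⟶ D) (h : B ⟶ D) (a : X ⟶ A)
    (b : X ⟶ B) (c : X ⟶ Q.carrier) :
    Q.Le (app (comp (graph Q f) (converse (graph Q h))) a b) c ↔
      ∀ {Z : C} (g : Z ⟶ X), g ≫ a ≫ f = g ≫ b ≫ h → Q.Le 1 (g ≫ c) := by
  rw [app_comp_converse_graph, graph_le]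

/-- The Beck–Chevalley condition: a weak pullback is enough since joins do not see
multiplicities. -/
lemma converse_graph_comp_graph {P A B D : C} {p : P ⟶ A} {q : P ⟶ B} {f : A ⟶ D} {h : B ⟶ D}
    (w : p ≫ f = q ≫ h)
    (exists_lift : ∀ {X : C} (a : X ⟶ A) (b : X ⟶ B), a ≫ f = b ≫ h →
      ∃ y : X ⟶ P, y ≫ p = a ∧ y ≫ q = b) :
    comp (converse (graph Q p)) (graph Q q) = comp (graph Q f) (converse (graph Q h)) := by
  refine ext' fun {X} a b => eq_of_le_iff fun c => ?_
  rw [converse_graph_comp_graph_le, graph_comp_converse_graph_le]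
  constructor
  · intro le Z g hg
    obtain ⟨y, hp, hq⟩ := exists_lift (g ≫ a) (g ≫ b) (by simpa using hg)
    exact le g y hp hq
  · intro le Z g y hp hq
    exact le g (by rw [← reassoc_of% hp, w, reassoc_of% hq])

lemma converse_comp {A B D : C} (R : A ⊗ B ⟶ Q.carrier) (S : B ⊗ D ⟶ Q.carrier) :
    converse (comp R S) = comp (converse S) (converse R) :=
  ext' fun a b => eq_of_le_iff fun c => by
    simp only [app_converse, comp_le, mul_comm (app R _ _)]

end QRel

namespace AlgVariety.Alg

variable {C : Type u} [Category.{v} C] [CartesianMonoidalCategory C] {V : AlgVariety.{w}}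

lemma whiskerLeft_hom (A : V.Alg C) {B D : V.Alg C} (f : B ⟶ D) :
    (A ◁ f).hom = A.carrier ◁ f.hom :=
  CartesianMonoidalCategory.hom_ext _ _
    ((congrArg Hom.hom (whiskerLeft_fst A f)).trans (whiskerLeft_fst _ _).symm)
    ((congrArg Hom.hom (whiskerLeft_snd A f)).trans (whiskerLeft_snd _ _).symm)

lemma whiskerRight_hom {A B : V.Alg C} (f : A ⟶ B) (D : V.Alg C) :
    (f ▷ D).hom = f.hom ▷ D.carrier :=
  CartesianMonoidalCategory.hom_ext _ _
    ((congrArg Hom.hom (whiskerRight_fst f D)).trans (whiskerRight_fst _ _).symm)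
    ((congrArg Hom.hom (whiskerRight_snd f D)).trans (whiskerRight_snd _ _).symm)

lemma isPullback_diag_diag_hom (A : V.Alg C) :
    IsPullback (lift (𝟙 A) (𝟙 A)).hom (lift (𝟙 A) (𝟙 A)).hom
      (lift (𝟙 A) (𝟙 A) ▷ A ≫ (α_ A A A).hom).hom (A ◁ lift (𝟙 A) (𝟙 A)).hom := by
  have whisker_assoc : (lift (𝟙 A) (𝟙 A) ▷ A ≫ (α_ A A A).hom).hom =
      lift (𝟙 A.carrier) (𝟙 A.carrier) ▷ A.carrier ≫ (α_ _ _ _).hom :=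
    congrArg₂ (· ≫ ·) (whiskerRight_hom _ _) (associator_hom _ _ _)
  rw [whisker_assoc, whiskerLeft_hom]
  exact isPullback_diag_diag A.carrier

end AlgVariety.Alg

namespace RelAlg

noncomputable section

open QRel

open scoped ComonObj

variable {C : Type u} [Category.{v} C] [CartesianMonoidalCategory C] [BraidedCategory C]
  [HasFiniteLimits C] [MonoidalClosed C] [HasSubobjectClassifier C] {V : AlgVariety.{w}}
  {Q : InternalQuantale C} [IsCommMonObj Q.carrier]

lemma conv_map_hom {A B : V.Alg C} (e : A ≅ B) :
    conv ((graphFunctor V Q).map e.hom) = (graphFunctor V Q).map e.inv :=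
  ext_rel (graph_iso (Q := Q) (A := B.carrier) (B := A.carrier)
    ⟨e.inv.hom, e.hom.hom, congrArg AlgVariety.Alg.Hom.hom e.inv_hom_id,
      congrArg AlgVariety.Alg.Hom.hom e.hom_inv_id⟩).symm

instance : DaggerSymmetricCategory (RelAlg V Q) where
  dagger := conv
  dagger_comp R S := ext_rel (converse_comp R.rel S.rel)
  dagger_dagger R := ext_rel (converse_converse R.rel)
  dagger_tensorHom R S := ext_rel (converse_tensor R.rel S.rel)
  dagger_associator_hom A B D := conv_map_hom (α_ A.alg B.alg D.alg)
  dagger_leftUnitor_hom A := conv_map_hom (λ_ A.alg)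
  dagger_braiding_hom A B := conv_map_hom (β_ A.alg B.alg)

lemma conv_id (A : RelAlg V Q) : conv (𝟙 A) = 𝟙 A := DaggerSymmetricCategory.dagger_id A

lemma conv_whiskerLeft (A : RelAlg V Q) {B D : RelAlg V Q} (R : B ⟶ D) :
    conv (A ◁ R) = A ◁ conv R := DaggerSymmetricCategory.dagger_whiskerLeft A R

lemma conv_map_comp_map {P A B D : V.Alg C} {p : P ⟶ A} {q : P ⟶ B} {f : A ⟶ D} {h : B ⟶ D}
    (sq : IsPullback p.hom q.hom f.hom h.hom) :
    conv ((graphFunctor V Q).map p) ≫ (graphFunctor V Q).map q =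
      (graphFunctor V Q).map f ≫ conv ((graphFunctor V Q).map h) :=
  ext_rel (converse_graph_comp_graph sq.w sq.exists_lift)

lemma map_whiskerLeft (A : V.Alg C) {B D : V.Alg C} (f : B ⟶ D) :
    (graphFunctor V Q).obj A ◁ (graphFunctor V Q).map f = (graphFunctor V Q).map (A ◁ f) := by
  rw [← id_tensorHom, ← id_tensorHom, ← graph_tensor, (graphFunctor V Q).map_id]

lemma map_whiskerRight {A B : V.Alg C} (f : A ⟶ B) (D : V.Alg C) :
    (graphFunctor V Q).map f ▷ (graphFunctor V Q).obj D = (graphFunctor V Q).map (f ▷ D) := by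
  rw [← tensorHom_id, ← tensorHom_id, ← graph_tensor, (graphFunctor V Q).map_id]

lemma map_tensorμ (A₁ A₂ B₁ B₂ : V.Alg C) :
    (graphFunctor V Q).map (tensorμ A₁ A₂ B₁ B₂) =
      tensorμ ((graphFunctor V Q).obj A₁) ((graphFunctor V Q).obj A₂) ((graphFunctor V Q).obj B₁)
        ((graphFunctor V Q).obj B₂) := by
  simp only [tensorμ, Functor.map_comp, ← map_whiskerLeft, ← map_whiskerRight]
  rfl

section

attribute [local instance] CartesianCopyDiscard.ofCartesianMonoidalCategory

instance (A : RelAlg V Q) : ComonObj A where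
  counit := (graphFunctor V Q).map (toUnit A.alg)
  comul := (graphFunctor V Q).map (lift (𝟙 A.alg) (𝟙 A.alg))
  counit_comul := by
    have h := congrArg (graphFunctor V Q).map (ComonObj.counit_comul A.alg)
    rw [Functor.map_comp, ← map_whiskerRight] at h
    exact h
  comul_counit := by
    have h := congrArg (graphFunctor V Q).map (ComonObj.comul_counit A.alg)
    rw [Functor.map_comp, ← map_whiskerLeft] at h
    exact h
  comul_assoc := by
    have h := congrArg (graphFunctor V Q).map (ComonObj.comul_assoc A.alg)
    simp only [Functor.map_comp, ← map_whiskerLeft, ← map_whiskerRight] at h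
    exact h

instance (A : RelAlg V Q) : IsCommComonObj A where
  comul_comm := ((graphFunctor V Q).map_comp _ _).symm.trans <|
    congrArg (graphFunctor V Q).map (IsCommComonObj.comul_comm A.alg)

instance : CopyDiscardCategory (RelAlg V Q) where
  copy_tensor A B := by
    have h := congrArg (graphFunctor V Q).map (CopyDiscardCategory.copy_tensor A.alg B.alg)
    rw [Functor.map_comp, ← graph_tensor, map_tensorμ] at h
    exact h
  discard_tensor A B := by
    have h := congrArg (graphFunctor V Q).map (CopyDiscardCategory.discard_tensor A.alg B.alg)
    rw [Functor.map_comp, ← graph_tensor] at h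
    exact h
  copy_unit := by
    have h := congrArg (graphFunctor V Q).map (CopyDiscardCategory.copy_unit (C := V.Alg C))
    exact h
  discard_unit := by
    have h := congrArg (graphFunctor V Q).map (CopyDiscardCategory.discard_unit (C := V.Alg C))
    exact h

end

lemma map_comp_conv_map {A B : V.Alg C} (f : A ⟶ B) [Mono f.hom] :
    (graphFunctor V Q).map f ≫ conv ((graphFunctor V Q).map f) = 𝟙 _ := by
  have kernel_pair : IsPullback (𝟙 A : A ⟶ A).hom (𝟙 A : A ⟶ A).hom f.hom f.hom :=
    IsKernelPair.id_of_mono f.hom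
  rw [← conv_map_comp_map kernel_pair, (graphFunctor V Q).map_id, conv_id, Category.comp_id]

lemma comul_comp_conv_comul (A : RelAlg V Q) : Δ[A] ≫ conv Δ[A] = 𝟙 A :=
  have : Mono (lift (𝟙 A.alg) (𝟙 A.alg)).hom :=
    inferInstanceAs (Mono (lift (𝟙 A.alg.carrier) (𝟙 A.alg.carrier)))
  map_comp_conv_map (lift (𝟙 A.alg) (𝟙 A.alg))

lemma frobenius (A : RelAlg V Q) :
    Δ[A] ▷ A ≫ (α_ A A A).hom ≫ A ◁ conv Δ[A] = conv Δ[A] ≫ Δ[A] := by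
  have h := conv_map_comp_map (Q := Q) (AlgVariety.Alg.isPullback_diag_diag_hom A.alg)
  rw [Functor.map_comp, ← map_whiskerLeft, ← map_whiskerRight] at h
  rw [← conv_whiskerLeft, ← Category.assoc]
  exact h.symm

end

end RelAlg

/-- The category of algebras and algebraic `Q`-relations is a hypergraph category, whose comonoids
are the graphs of the terminal and diagonal maps and whose monoids are the converses of these. -/
theorem mainTheorem1 {C : Type u} [Category.{v} C] [CartesianMonoidalCategory C]
    [BraidedCategory C] [HasFiniteLimits C] [MonoidalClosed C] [HasSubobjectClassifier C]
    (V : AlgVariety.{w}) (Q : InternalQuantale C) [IsCommMonObj Q.carrier] :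
    ∃ H : HypergraphCategory (RelAlg V Q), ∀ A : RelAlg V Q,
      (H.comon A).counit = (RelAlg.graphFunctor V Q).map (toUnit A.alg) ∧
      (H.comon A).comul = (RelAlg.graphFunctor V Q).map (lift (𝟙 A.alg) (𝟙 A.alg)) ∧
      (H.mon A).one = RelAlg.conv ((RelAlg.graphFunctor V Q).map (toUnit A.alg)) ∧
      (H.mon A).mul = RelAlg.conv ((RelAlg.graphFunctor V Q).map (lift (𝟙 A.alg) (𝟙 A.alg))) :=
  ⟨DaggerSymmetricCategory.hypergraphCategory RelAlg.frobenius RelAlg.comul_comp_conv_comul,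
    fun _ => ⟨rfl, rfl, rfl, rfl⟩⟩
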